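/- Let $n\ge k\ge 0$ and $N\ge 0$ be integers. Let $L_{n,k}$ be the set of truncated lecture hall partitions, that is, of nonincreasing sequences $\lambda=(\lambda_1,\dots,\lambda_k)$ of nonnegative integers satisfying $$\frac{\lambda_1}{n}\ \ge\ \frac{\lambda_2}{n-1}\ \ge\ \cdots\ \ge\ \frac{\lambda_k}{n-k+1}\ \ge\ 0 .$$ Then the number of $\lambda\in L_{n,k}$ with $\lambda_1+\cdots+\lambda_k=N$ is finite and equals the number of partitions of $N$ into odd parts less than $2n$ in which at most $\lfloor k/2\rfloor$ parts (counted with multiplicity) belong to the set $$\{2\lceil k/2\rceil+1,\ 2\lceil k/2\rceil+3,\ \dots,\ 2(n-\lfloor k/2\rfloor)-1\},$$ which is empty when $k=n$. -/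

import Mathlib

/-- The set `L_{n,k}` of truncated lecture hall partitions: nonincreasing sequences
`(l_1, …, l_k)` of nonnegative integers with
`l_1 / n ≥ l_2 / (n - 1) ≥ ⋯ ≥ l_k / (n - k + 1) ≥ 0` (quotients in `ℚ`), meant for `k ≤ n`,
so that all the denominators are positive.
Indices start at `0` here: `l i` stands for `l_{i+1}`, with denominator `n - i`. -/
def truncatedLectureHall (n k : ℕ) : Set (Fin k → ℕ) :=
  {l | Antitone l ∧
    (∀ i j : Fin k, (j : ℕ) = (i : ℕ) + 1 →
      (l j : ℚ) / ((n : ℚ) - (j : ℕ)) ≤ (l i : ℚ) / ((n : ℚ) - (i : ℕ))) ∧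
    ∀ i : Fin k, (i : ℕ) + 1 = k → 0 ≤ (l i : ℚ) / ((n : ℚ) - (i : ℕ))}

/-- Membership in `{2⌈k/2⌉ + 1, 2⌈k/2⌉ + 3, …, 2(n - ⌊k/2⌋) - 1}`, meant for `k ≤ n`
(the set is empty when `k = n`). In `ℕ`, `(k + 1) / 2 = ⌈k/2⌉` and `k / 2 = ⌊k/2⌋`. -/
abbrev IsRestrictedPart (n k a : ℕ) : Prop :=
  Odd a ∧ 2 * ((k + 1) / 2) + 1 ≤ a ∧ a + 1 ≤ 2 * (n - k / 2)

/-- The partitions of `N` into odd parts less than `2n` in which at most `⌊k/2⌋` parts, counted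
with multiplicity, lie in `{2⌈k/2⌉ + 1, 2⌈k/2⌉ + 3, …, 2(n - ⌊k/2⌋) - 1}`. -/
def restrictedOddPartitions (n k N : ℕ) : Set (Nat.Partition N) :=
  {p | (∀ a ∈ p.parts, Odd a ∧ a < 2 * n) ∧
    p.parts.countP (fun a => IsRestrictedPart n k a) ≤ k / 2}

/-!
Both sides are compared through generating functions in `q`, by their increments in `k`.

Let `A k` be the generating function of the lecture hall partitions of `L_{n,k}` with exactly `k`
positive parts, so that `L_{n,k}` has generating function `∑ j ≤ k, A j`. If `j` is the number of
parts exceeding the corresponding part of the staircase `n, n - 1, …`, then subtracting the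
staircase from the first `j` parts leaves a lecture hall partition with `j` positive parts, while
the remaining `k - j` parts form an arbitrary `(k - j)`-element subset of `{1, …, n - j}`. This
gives a recurrence expressing `A k` through `A 0, …, A k` (`weightGenFun_posLectureHallSeq`), which
determines `A k` for `k ≥ 1` because the coefficient of `A k` on the right is a positive power of
`q`. The `q`-Chu–Vandermonde sum in base `q⁻¹` (`sum_gaussBinom_mul`) shows that the solution satisfies
`A k * ∏ i < k, (1 - q ^ (i + 1)) (1 - q ^ (2 n - i)) =
q ^ (k (k + 1) / 2) * ∏ i < k, (1 - q ^ (2 (n - i)))`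
(`closed_form_of_recurrence`, `posLectureHallSeq_closed_form`).

On the other side, passing from `k - 1` to `k` removes one odd number from the restricted set, and
raises the bound by one if `k` is even. The increment of the generating function is therefore, up
to a factor, a complete homogeneous sum of degree `⌊k/2⌋` in consecutive odd powers of `q`
(`boundedGenFun_sub_of_bound_succ`, `boundedGenFun_sub_of_bound_eq`). Such a sum is a Gaussian
binomial in base `q ^ 2` (`exactGenFun_oddNumbers`), and the increment turns out to be given by the
same product (`restrictedOddGenFun_sub`).
-/

/-! ### Generating functions of weighted sets -/

/-- The generating function `∑ a ∈ S, X ^ w a` of a set `S` for the weight `w`: its `N`-th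
coefficient is the number of elements of `S` of weight `N`. It is meant for sets with finitely
many elements of each weight; `Set.ncard` gives the coefficient `0` to an infinite fibre. -/
noncomputable def weightGenFun {α : Type*} (w : α → ℕ) (S : Set α) : PowerSeries ℤ :=
  PowerSeries.mk fun N => (({a | a ∈ S ∧ w a = N} : Set α).ncard : ℤ)

/-- If `T` is the disjoint union of injective images of finitely many sets `S i`, and the `i`-th
injection raises the weight by `c i`, then the generating function of `T` is
`∑ i, X ^ c i * (generating function of S i)`. -/
theorem weightGenFun_eq_sum {α β ι : Type*} {w : α → ℕ} {w' : β → ℕ} (I : Finset ι)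
    (S : ι → Set α) (T : Set β) (φ : ι → α → β) (c : ι → ℕ)
    (hfin : ∀ N, ({b | b ∈ T ∧ w' b = N} : Set β).Finite)
    (hmaps : ∀ i ∈ I, ∀ a ∈ S i, φ i a ∈ T)
    (hwt : ∀ i ∈ I, ∀ a ∈ S i, w' (φ i a) = w a + c i)
    (hinj : ∀ i ∈ I, ∀ j ∈ I, ∀ a ∈ S i, ∀ b ∈ S j, φ i a = φ j b → i = j ∧ a = b)
    (hsurj : ∀ t ∈ T, ∃ i ∈ I, ∃ a ∈ S i, φ i a = t) :
    weightGenFun w' T = ∑ i ∈ I, PowerSeries.X ^ c i * weightGenFun w (S i) := by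
  ext N
  rw [map_sum]
  have hT : {b | b ∈ T ∧ w' b = N} = ⋃ i ∈ (I : Set ι), φ i '' {a | a ∈ S i ∧ w a + c i = N} := by
    ext t
    simp only [Set.mem_ofPred_eq, Set.mem_iUnion, Set.mem_image, exists_prop, Finset.mem_coe]
    constructor
    · rintro ⟨ht, hN⟩
      obtain ⟨i, hi, a, ha, rfl⟩ := hsurj t ht
      exact ⟨i, hi, a, ⟨ha, by rw [← hwt i hi a ha, hN]⟩, rfl⟩
    · rintro ⟨i, hi, a, ⟨ha, hN⟩, rfl⟩
      exact ⟨hmaps i hi a ha, by rw [hwt i hi a ha, hN]⟩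
  have hfin' := hfin N
  simp only [weightGenFun, PowerSeries.coeff_mk, PowerSeries.coeff_X_pow_mul']
  rw [hT] at hfin' ⊢
  rw [Set.Finite.ncard_biUnion I.finite_toSet
    (fun i hi => hfin'.subset (Set.subset_biUnion_of_mem hi))]
  · rw [finsum_mem_coe_finset, Nat.cast_sum]
    refine Finset.sum_congr rfl fun i hi => ?_
    rw [Set.InjOn.ncard_image (fun a ha b hb hab => (hinj i hi i hi a ha.1 b hb.1 hab).2)]
    split_ifs with h
    · congr 3
      ext a
      simp only [and_congr_right_iff]
      omega
    · rw [Nat.cast_eq_zero]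
      convert Set.ncard_empty α
      ext a
      simp only [Set.mem_ofPred_eq, Set.mem_empty_iff_false, iff_false, not_and]
      omega
  · intro i hi j hj hij
    rw [Function.onFun, Set.disjoint_left]
    rintro _ ⟨a, ha, rfl⟩ ⟨b, hb, hab⟩
    exact hij (hinj i hi j hj a ha.1 b hb.1 hab.symm).1

/-! ### Strictly decreasing sequences -/

/-- The elements of a finite set of natural numbers in decreasing order, followed by zeros. -/
def decreasingSeq (S : Finset ℕ) (t : ℕ) : ℕ := (S.sort (· ≥ ·)).getD t 0

theorem decreasingSeq_mem {S : Finset ℕ} {t : ℕ} (h : t < S.card) : decreasingSeq S t ∈ S := by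
  have h' : t < (S.sort (· ≥ ·)).length := by simpa using h
  rw [decreasingSeq, List.getD_eq_getElem _ _ h', ← Finset.mem_sort (· ≥ ·)]
  exact List.getElem_mem h'

theorem decreasingSeq_of_card_le {S : Finset ℕ} {t : ℕ} (h : S.card ≤ t) :
    decreasingSeq S t = 0 :=
  List.getD_eq_default _ _ (by simpa using h)

theorem decreasingSeq_succ_lt {S : Finset ℕ} {t : ℕ} (h : t + 1 < S.card) :
    decreasingSeq S (t + 1) < decreasingSeq S t := by
  have h' : t + 1 < (S.sort (· ≥ ·)).length := by simpa using h
  rw [decreasingSeq, decreasingSeq, List.getD_eq_getElem _ _ h',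
    List.getD_eq_getElem _ _ (Nat.lt_of_succ_lt h')]
  exact (List.pairwise_iff_getElem.mp S.sortedGT_sort.pairwise) _ _ _ _ (Nat.lt_succ_self t)

theorem exists_decreasingSeq_eq {S : Finset ℕ} {v : ℕ} (h : v ∈ S) :
    ∃ t < S.card, decreasingSeq S t = v := by
  rw [← Finset.mem_sort (· ≥ ·)] at h
  obtain ⟨t, ht, rfl⟩ := List.getElem_of_mem h
  exact ⟨t, by simpa using ht, List.getD_eq_getElem _ _ ht⟩

theorem sum_decreasingSeq {S : Finset ℕ} {M : ℕ} (h : S.card ≤ M) :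
    ∑ t ∈ Finset.range M, decreasingSeq S t = ∑ v ∈ S, v := by
  have hz : ∑ t ∈ Finset.range M, decreasingSeq S t
      = ∑ t ∈ Finset.range S.card, decreasingSeq S t := by
    refine (Finset.sum_subset (Finset.range_mono h) fun t _ ht => ?_).symm
    exact decreasingSeq_of_card_le (by simpa using ht)
  have hanti : StrictAntiOn (decreasingSeq S) (Set.Iio S.card) := by
    intro a ha b hb hab
    have ha' : a < (S.sort (· ≥ ·)).length := by simpa using ha
    have hb' : b < (S.sort (· ≥ ·)).length := by simpa using hb
    rw [decreasingSeq, decreasingSeq, List.getD_eq_getElem _ _ ha', List.getD_eq_getElem _ _ hb']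
    exact (List.pairwise_iff_getElem.mp S.sortedGT_sort.pairwise) _ _ _ _ hab
  rw [hz]
  refine Finset.sum_bij (fun t _ => decreasingSeq S t) (fun t ht => ?_) (fun a ha b hb hab => ?_)
    (fun v hv => ?_) (fun t _ => rfl)
  · exact decreasingSeq_mem (by simpa using ht)
  · exact hanti.injOn (by simpa using ha) (by simpa using hb) hab
  · obtain ⟨t, ht, rfl⟩ := exists_decreasingSeq_eq hv
    exact ⟨t, by simpa using ht, rfl⟩

/-- Every sequence that strictly decreases on `[0, l)` and vanishes afterwards is the
`decreasingSeq` of its set of first `l` values. -/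
theorem decreasingSeq_image {d : ℕ → ℕ} {l : ℕ} (hd : ∀ t, t + 1 < l → d (t + 1) < d t)
    (hz : ∀ t, l ≤ t → d t = 0) :
    ((Finset.range l).image d).card = l ∧ decreasingSeq ((Finset.range l).image d) = d := by
  have hanti : ∀ a b, a < b → b < l → d b < d a := by
    intro a b hab
    induction b, hab using Nat.le_induction with
    | base => exact hd a
    | succ b hb ih => exact fun h => (hd b h).trans (ih (by omega))
  have hcard : ((Finset.range l).image d).card = l := by
    rw [Finset.card_image_of_injOn, Finset.card_range]
    intro a ha b hb hab
    simp only [Finset.coe_range, Set.mem_Iio] at ha hb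
    rcases lt_trichotomy a b with h | h | h
    · exact absurd hab (hanti a b h hb).ne'
    · exact h
    · exact absurd hab (hanti b a h ha).ne
  refine ⟨hcard, funext fun t => ?_⟩
  rcases lt_or_ge t l with ht | ht
  · have hpw : ((List.range l).map d).Pairwise (· > ·) := by
      rw [List.pairwise_iff_getElem]
      intro i j hi hj hij
      simp only [List.getElem_map, List.getElem_range]
      exact hanti i j hij (by simpa using hj)
    have hS : (Finset.range l).image d = ((List.range l).map d).toFinset := by
      ext v; simp
    have hsort : ((List.range l).map d).toFinset.sort (· ≥ ·) = (List.range l).map d :=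
      (List.toFinset_sort _ (hpw.imp fun h => ne_of_gt h)).2 (hpw.imp fun h => le_of_lt h)
    rw [decreasingSeq, hS, hsort, List.getD_eq_getElem _ _ (by simpa using ht)]
    simp
  · rw [hz t ht, decreasingSeq_of_card_le (by omega)]

/-! ### Lecture hall sequences -/

/-- The truncated lecture hall partitions of `L_{n,k}`, extended by zeros to sequences indexed by
`ℕ`. -/
def lectureHallSeq (n k : ℕ) : Set (ℕ → ℕ) :=
  {f | (∀ i, f (i + 1) * (n - i) ≤ f i * (n - (i + 1))) ∧ ∀ i, k ≤ i → f i = 0}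

/-- The truncated lecture hall partitions with exactly `k` positive parts. -/
def posLectureHallSeq (n k : ℕ) : Set (ℕ → ℕ) :=
  {f | f ∈ lectureHallSeq n k ∧ ∀ i < k, 0 < f i}

theorem finite_support_sum (n N : ℕ) :
    ({f : ℕ → ℕ | (∀ i, n ≤ i → f i = 0) ∧ ∑ i ∈ Finset.range n, f i = N}).Finite := by
  refine Set.Finite.of_injOn (f := fun f (i : Fin n) => f i)
    (t := Set.Iic (fun _ => N)) ?_ ?_ (Set.finite_Iic _)
  · rintro f ⟨_, hf⟩ i
    rw [← hf]
    exact Finset.single_le_sum (f := f) (fun _ _ => Nat.zero_le _)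
      (Finset.mem_range.2 i.2)
  · rintro f ⟨hf, _⟩ g ⟨hg, _⟩ h
    funext i
    rcases lt_or_ge i n with hi | hi
    · exact congrFun h ⟨i, hi⟩
    · rw [hf i hi, hg i hi]

/-- Lecture hall partitions sorted by their number of positive parts. -/
theorem weightGenFun_lectureHallSeq (n k : ℕ) (hk : k ≤ n) :
    weightGenFun (fun f => ∑ i ∈ Finset.range n, f i) (lectureHallSeq n k) =
      ∑ j ∈ Finset.range (k + 1),
        weightGenFun (fun f => ∑ i ∈ Finset.range n, f i) (posLectureHallSeq n j) := by
  rw [weightGenFun_eq_sum (w := fun f => ∑ i ∈ Finset.range n, f i) (Finset.range (k + 1))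
    (posLectureHallSeq n) (lectureHallSeq n k) (fun _ f => f) (fun _ => 0)]
  · simp
  · exact fun N => (finite_support_sum n N).subset
      fun f hf => ⟨fun i hi => hf.1.2 i (hk.trans hi), hf.2⟩
  · exact fun j hj f hf => ⟨hf.1.1, fun i hi => hf.1.2 i (by rw [Finset.mem_range] at hj; omega)⟩
  · exact fun _ _ _ _ => rfl
  · rintro i - j - f hf g hg rfl
    refine ⟨?_, rfl⟩
    rcases lt_trichotomy i j with h | h | h
    · exact absurd (hf.1.2 i le_rfl) (hg.2 i h).ne'
    · exact h
    · exact absurd (hg.1.2 j le_rfl) (hf.2 j h).ne'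
  · intro f hf
    have hex : ∃ j, f j = 0 := ⟨k, hf.2 k le_rfl⟩
    have hj : Nat.find hex ≤ k := Nat.find_min' hex (hf.2 k le_rfl)
    refine ⟨Nat.find hex, by rw [Finset.mem_range]; omega, f, ⟨⟨hf.1, fun i hi => ?_⟩, fun i hi =>
      Nat.pos_of_ne_zero (Nat.find_min hex hi)⟩, rfl⟩
    induction i, hi using Nat.le_induction with
    | base => exact Nat.find_spec hex
    | succ i hi ih =>
      rcases lt_or_ge i n with hin | hin
      · have := hf.1 i
        rw [ih, Nat.zero_mul, Nat.le_zero, Nat.mul_eq_zero] at this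
        omega
      · exact hf.2 _ (by omega)

/-- The inverse of the decomposition of a lecture hall partition: put a copy of the staircase
`n, n - 1, …` on top of the first `j` parts `g`, and append the elements of `S` in decreasing
order. -/
def addStaircaseAppend (n j : ℕ) (S : Finset ℕ) (g : ℕ → ℕ) (i : ℕ) : ℕ :=
  if i < j then g i + (n - i) else decreasingSeq S (i - j)

theorem decreasingSeq_le_sub {S : Finset ℕ} {m : ℕ} (hS : S ⊆ Finset.Icc 1 m) (t : ℕ) :
    decreasingSeq S t ≤ m - t := by
  induction t with
  | zero =>
    rcases Nat.eq_zero_or_pos S.card with h | h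
    · rw [decreasingSeq_of_card_le h.le]; omega
    · exact (Finset.mem_Icc.1 (hS (decreasingSeq_mem h))).2
  | succ t ih =>
    rcases lt_or_ge (t + 1) S.card with h | h
    · have := decreasingSeq_succ_lt h
      omega
    · rw [decreasingSeq_of_card_le h]; omega

theorem addStaircaseAppend_mem {n k j : ℕ} (hk : k ≤ n) (hj : j ≤ k) {S : Finset ℕ}
    (hS : S ∈ Finset.powersetCard (k - j) (Finset.Icc 1 (n - j))) {g : ℕ → ℕ}
    (hg : g ∈ posLectureHallSeq n j) : addStaircaseAppend n j S g ∈ posLectureHallSeq n k := by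
  obtain ⟨hS, hcard⟩ := Finset.mem_powersetCard.1 hS
  have hle := decreasingSeq_le_sub hS
  refine ⟨⟨fun i => ?_, fun i hi => ?_⟩, fun i hi => ?_⟩
  · unfold addStaircaseAppend
    rcases lt_trichotomy (i + 1) j with h | h | h
    · rw [if_pos h, if_pos (by omega)]
      have := hg.1.1 i
      nlinarith
    · rw [if_neg (by omega), if_pos (by omega)]
      have := hle (i + 1 - j)
      have h2 : decreasingSeq S (i + 1 - j) ≤ n - (i + 1) := by omega
      calc decreasingSeq S (i + 1 - j) * (n - i) ≤ (n - (i + 1)) * (n - i) :=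
            Nat.mul_le_mul_right _ h2
        _ ≤ (g i + (n - i)) * (n - (i + 1)) := by rw [mul_comm]; gcongr; omega
    · rw [if_neg (by omega), if_neg (by omega)]
      obtain ⟨t, rfl⟩ : ∃ t, i = j + t := ⟨i - j, by omega⟩
      rw [show j + t + 1 - j = t + 1 by omega, show j + t - j = t by omega]
      rcases lt_or_ge (t + 1) S.card with ht | ht
      · have h1 := decreasingSeq_succ_lt ht
        have h2 := hle t
        obtain ⟨u, hu⟩ : ∃ u, n - (j + t) = u + 1 := ⟨n - (j + t) - 1, by omega⟩
        rw [hu, show n - (j + t + 1) = u by omega]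
        have h3 : decreasingSeq S t ≤ u + 1 := by omega
        nlinarith
      · rw [decreasingSeq_of_card_le ht]; simp
  · unfold addStaircaseAppend
    rw [if_neg (by omega), decreasingSeq_of_card_le (by omega)]
  · unfold addStaircaseAppend
    split_ifs with h
    · have := hg.2 i h; omega
    · exact (Finset.mem_Icc.1 (hS (decreasingSeq_mem (by omega)))).1

theorem sum_addStaircaseAppend {n k j : ℕ} (hk : k ≤ n) (hj : j ≤ k) {S : Finset ℕ}
    (hS : S ∈ Finset.powersetCard (k - j) (Finset.Icc 1 (n - j))) {g : ℕ → ℕ}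
    (hg : g ∈ posLectureHallSeq n j) :
    ∑ i ∈ Finset.range n, addStaircaseAppend n j S g i =
      ∑ i ∈ Finset.range n, g i + (∑ i ∈ Finset.range j, (n - i) + ∑ v ∈ S, v) := by
  obtain ⟨-, hcard⟩ := Finset.mem_powersetCard.1 hS
  obtain ⟨r, rfl⟩ : ∃ r, n = j + r := ⟨n - j, by omega⟩
  rw [Finset.sum_range_add, Finset.sum_range_add (fun i => g i)]
  have h1 : ∑ i ∈ Finset.range j, addStaircaseAppend (j + r) j S g i =
      ∑ i ∈ Finset.range j, g i + ∑ i ∈ Finset.range j, (j + r - i) := by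
    rw [← Finset.sum_add_distrib]
    exact Finset.sum_congr rfl fun i hi => if_pos (Finset.mem_range.1 hi)
  have h2 : ∑ i ∈ Finset.range r, addStaircaseAppend (j + r) j S g (j + i) = ∑ v ∈ S, v := by
    rw [← sum_decreasingSeq (M := r) (by omega)]
    refine Finset.sum_congr rfl fun i _ => ?_
    rw [addStaircaseAppend, if_neg (by omega), show j + i - j = i by omega]
  have h3 : ∑ i ∈ Finset.range r, g (j + i) = 0 :=
    Finset.sum_eq_zero fun i _ => hg.1.2 _ (by omega)
  rw [h1, h2, h3]
  ring

/-- The number `j` can be recovered from the sequence `addStaircaseAppend n j S g`. -/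
theorem addStaircaseAppend_lt_iff {n k j : ℕ} {S : Finset ℕ}
    (hS : S ∈ Finset.powersetCard (k - j) (Finset.Icc 1 (n - j))) {g : ℕ → ℕ}
    (hg : g ∈ posLectureHallSeq n j) (i : ℕ) : n - i < addStaircaseAppend n j S g i ↔ i < j := by
  unfold addStaircaseAppend
  split_ifs with h
  · have := hg.2 i h; simp only [h, iff_true]; omega
  · have := decreasingSeq_le_sub (Finset.mem_powersetCard.1 hS).1 (i - j)
    simp only [h, iff_false]; omega

theorem addStaircaseAppend_injective {n k j j' : ℕ}
    {S S' : Finset ℕ} (hS : S ∈ Finset.powersetCard (k - j) (Finset.Icc 1 (n - j)))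
    (hS' : S' ∈ Finset.powersetCard (k - j') (Finset.Icc 1 (n - j'))) {g g' : ℕ → ℕ}
    (hg : g ∈ posLectureHallSeq n j) (hg' : g' ∈ posLectureHallSeq n j')
    (h : addStaircaseAppend n j S g = addStaircaseAppend n j' S' g') :
    j = j' ∧ S = S' ∧ g = g' := by
  have hjj : j = j' := by
    have h1 := addStaircaseAppend_lt_iff hS hg
    have h2 := addStaircaseAppend_lt_iff hS' hg'
    rw [← h] at h2
    have h3 : ∀ i, i < j ↔ i < j' := fun i => (h1 i).symm.trans (h2 i)
    have := h3 j; have := h3 j'; omega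
  subst hjj
  have hd : decreasingSeq S = decreasingSeq S' := by
    funext t
    have := congrFun h (j + t)
    simpa [addStaircaseAppend] using this
  have hsub : ∀ {A B : Finset ℕ}, A ∈ Finset.powersetCard (k - j) (Finset.Icc 1 (n - j)) →
      B ∈ Finset.powersetCard (k - j) (Finset.Icc 1 (n - j)) →
      decreasingSeq A = decreasingSeq B → A ⊆ B := by
    intro A B hA hB hAB v hv
    obtain ⟨t, ht, rfl⟩ := exists_decreasingSeq_eq hv
    rw [hAB]
    refine decreasingSeq_mem ?_
    rw [(Finset.mem_powersetCard.1 hB).2, ← (Finset.mem_powersetCard.1 hA).2]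
    exact ht
  refine ⟨rfl, (hsub hS hS' hd).antisymm (hsub hS' hS hd.symm), funext fun i => ?_⟩
  rcases lt_or_ge i j with hi | hi
  · have := congrFun h i
    simpa [addStaircaseAppend, hi] using this
  · rw [hg.1.2 i hi, hg'.1.2 i hi]

/-- Every lecture hall partition with `k` positive parts decomposes: `j` is the number of parts
exceeding the corresponding part `n - i` of the staircase. The parts after these are strictly
decreasing. -/
theorem exists_addStaircaseAppend_eq {n k : ℕ} (hk : k ≤ n) {f : ℕ → ℕ}
    (hf : f ∈ posLectureHallSeq n k) :
    ∃ j ≤ k, ∃ S ∈ Finset.powersetCard (k - j) (Finset.Icc 1 (n - j)),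
      ∃ g ∈ posLectureHallSeq n j, addStaircaseAppend n j S g = f := by
  obtain ⟨⟨hf1, hf2⟩, hf3⟩ := hf
  have hex : ∃ j, f j ≤ n - j := ⟨k, by rw [hf2 k le_rfl]; exact Nat.zero_le _⟩
  obtain ⟨j, hj, hmin⟩ : ∃ j, f j ≤ n - j ∧ ∀ i < j, n - i < f i :=
    ⟨Nat.find hex, Nat.find_spec hex, fun i hi => not_le.1 (Nat.find_min hex hi)⟩
  have hjk : j ≤ k := by
    by_contra hlt
    have := hmin k (by omega)
    rw [hf2 k le_rfl] at this
    omega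
  have hstep : ∀ i < k, f i ≤ n - i → f (i + 1) < f i ∧ f (i + 1) ≤ n - (i + 1) := by
    intro i hi hle
    have h1 := hf1 i
    have h2 := hf3 i hi
    have hlt : f (i + 1) < f i := by
      by_contra hcon
      obtain ⟨u, hu⟩ : ∃ u, n - i = u + 1 := ⟨n - i - 1, by omega⟩
      rw [hu, show n - (i + 1) = u by omega] at h1
      nlinarith
    exact ⟨hlt, by omega⟩
  have hle : ∀ i, j ≤ i → f i ≤ n - i := by
    intro i hi
    induction i, hi using Nat.le_induction with
    | base => exact hj
    | succ i hi ih =>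
      rcases lt_or_ge i k with h | h
      · exact (hstep i h ih).2
      · rw [hf2 _ (by omega)]; exact Nat.zero_le _
  obtain ⟨hcard, hseq⟩ := decreasingSeq_image (d := fun t => f (j + t)) (l := k - j)
    (fun t ht => (hstep (j + t) (by omega) (hle _ (by omega))).1) (fun t ht => hf2 _ (by omega))
  refine ⟨j, hjk, _, Finset.mem_powersetCard.2 ⟨?_, hcard⟩,
    fun i => if i < j then f i - (n - i) else 0, ⟨⟨fun i => ?_, fun i hi => ?_⟩, fun i hi => ?_⟩,
    funext fun i => ?_⟩
  · intro v hv
    obtain ⟨t, ht, rfl⟩ := Finset.mem_image.1 hv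
    rw [Finset.mem_range] at ht
    have h1 := hf3 (j + t) (by omega)
    have h2 := hle (j + t) (by omega)
    exact Finset.mem_Icc.2 ⟨h1, by omega⟩
  · rcases lt_or_ge (i + 1) j with h | h
    · have h1 := hf1 i
      simp only [if_pos h, if_pos (show i < j by omega)]
      obtain ⟨a, ha⟩ := Nat.exists_eq_add_of_lt (hmin i (by omega))
      obtain ⟨b, hb⟩ := Nat.exists_eq_add_of_lt (hmin (i + 1) h)
      rw [ha, hb] at h1 ⊢
      rw [show n - i + a + 1 - (n - i) = a + 1 by omega,
        show n - (i + 1) + b + 1 - (n - (i + 1)) = b + 1 by omega]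
      nlinarith
    · simp [not_lt.2 h]
  · exact if_neg (not_lt.2 hi)
  · have := hmin i hi
    beta_reduce
    rw [if_pos hi]
    omega
  · unfold addStaircaseAppend
    split_ifs with h
    · beta_reduce
      rw [if_pos h, Nat.sub_add_cancel (hmin i h).le]
    · rw [hseq]
      simp only
      congr 1
      omega

/-- The recurrence obtained by removing the staircase from the parts that exceed it. -/
theorem weightGenFun_posLectureHallSeq (n k : ℕ) (hk : k ≤ n) :
    weightGenFun (fun f => ∑ i ∈ Finset.range n, f i) (posLectureHallSeq n k) =
      ∑ j ∈ Finset.range (k + 1),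
        PowerSeries.X ^ (∑ i ∈ Finset.range j, (n - i)) *
          (∑ S ∈ Finset.powersetCard (k - j) (Finset.Icc 1 (n - j)), PowerSeries.X ^ ∑ v ∈ S, v) *
          weightGenFun (fun f => ∑ i ∈ Finset.range n, f i) (posLectureHallSeq n j) := by
  rw [weightGenFun_eq_sum (w := fun f => ∑ i ∈ Finset.range n, f i)
    ((Finset.range (k + 1)).sigma fun j => Finset.powersetCard (k - j) (Finset.Icc 1 (n - j)))
    (fun x => posLectureHallSeq n x.1) (posLectureHallSeq n k)
    (fun x => addStaircaseAppend n x.1 x.2)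
    (fun x => ∑ i ∈ Finset.range x.1, (n - i) + ∑ v ∈ x.2, v)]
  · rw [Finset.sum_sigma]
    refine Finset.sum_congr rfl fun j _ => ?_
    rw [Finset.mul_sum, Finset.sum_mul]
    exact Finset.sum_congr rfl fun S _ => by rw [pow_add]
  · exact fun N => (finite_support_sum n N).subset
      fun f hf => ⟨fun i hi => hf.1.1.2 i (hk.trans hi), hf.2⟩
  all_goals simp only [Finset.mem_sigma, Finset.mem_range, Nat.lt_succ_iff]
  · exact fun x hx g hg => addStaircaseAppend_mem hk hx.1 hx.2 hg
  · exact fun x hx g hg => sum_addStaircaseAppend hk hx.1 hx.2 hg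
  · rintro ⟨j, S⟩ hx ⟨j', S'⟩ hx' g hg g' hg' h
    obtain ⟨rfl, rfl, rfl⟩ := addStaircaseAppend_injective hx.2 hx'.2 hg hg' h
    exact ⟨rfl, rfl⟩
  · intro f hf
    obtain ⟨j, hj, S, hS, g, hg, h⟩ := exists_addStaircaseAppend_eq hk hf
    exact ⟨⟨j, S⟩, ⟨hj, hS⟩, g, hg, h⟩

theorem weightGenFun_posLectureHallSeq_zero (n : ℕ) :
    weightGenFun (fun f => ∑ i ∈ Finset.range n, f i) (posLectureHallSeq n 0) = 1 := by
  have h0 : posLectureHallSeq n 0 = {0} := by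
    ext f
    constructor
    · exact fun hf => funext fun i => hf.1.2 i (Nat.zero_le i)
    · rintro rfl
      exact ⟨⟨fun i => by simp, fun _ _ => rfl⟩, fun i hi => absurd hi (Nat.not_lt_zero i)⟩
  ext N
  rw [weightGenFun, PowerSeries.coeff_mk, PowerSeries.coeff_one, h0]
  split_ifs with hN
  · rw [Nat.cast_eq_one, Set.ncard_eq_one]
    refine ⟨0, Set.ext fun f => ?_⟩
    constructor
    · exact fun h => h.1
    · rintro rfl
      exact ⟨rfl, by simp [hN]⟩
  · rw [Nat.cast_eq_zero]
    convert Set.ncard_empty (ℕ → ℕ)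
    ext f
    simp only [Set.mem_empty_iff_false, iff_false]
    rintro ⟨rfl, h⟩
    exact hN (by simpa using h.symm)

/-! ### Gaussian binomials and the `q`-Chu–Vandermonde sum -/

/-- The Gaussian binomial coefficient `[k choose j]` in base `p`, defined by its Pascal
recurrence. -/
def gaussBinom {R : Type*} [CommRing R] (p : R) : ℕ → ℕ → R
  | _, 0 => 1
  | 0, _ + 1 => 0
  | k + 1, j + 1 => gaussBinom p k (j + 1) + p ^ (k - j) * gaussBinom p k j

theorem gaussBinom_of_lt {R : Type*} [CommRing R] (p : R) {k j : ℕ} (h : k < j) :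
    gaussBinom p k j = 0 := by
  induction k generalizing j with
  | zero =>
    obtain ⟨j, rfl⟩ := Nat.exists_eq_succ_of_ne_zero h.ne'
    rfl
  | succ k ih =>
    obtain ⟨j, rfl⟩ := Nat.exists_eq_succ_of_ne_zero (Nat.ne_zero_of_lt h)
    rw [gaussBinom, ih (by omega), ih (by omega)]
    ring

theorem gaussBinom_zero_right {R : Type*} [CommRing R] (p : R) (k : ℕ) :
    gaussBinom p k 0 = 1 := by
  cases k <;> rfl

theorem gaussBinom_mul_prod {R : Type*} [CommRing R] (p : R) (j l : ℕ) :
    gaussBinom p (j + l) j * (∏ i ∈ Finset.range j, (p ^ (i + 1) - 1)) *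
      (∏ i ∈ Finset.range l, (p ^ (i + 1) - 1)) = ∏ i ∈ Finset.range (j + l), (p ^ (i + 1) - 1) := by
  obtain ⟨s, hs⟩ : ∃ s, s = j + l := ⟨_, rfl⟩
  induction s generalizing j l with
  | zero =>
    obtain ⟨rfl, rfl⟩ : j = 0 ∧ l = 0 := by omega
    simp [gaussBinom]
  | succ s ih =>
    rcases j with _ | j
    · simp [gaussBinom_zero_right]
    rcases l with _ | l
    · have h := ih j 0 (by omega)
      simp only [Nat.add_zero, Finset.range_zero, Finset.prod_empty, mul_one] at h ⊢
      rw [gaussBinom, gaussBinom_of_lt p (Nat.lt_succ_self j), Nat.sub_self, zero_add, pow_zero,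
        one_mul, Finset.prod_range_succ, ← mul_assoc, h]
    · have h1 := ih (j + 1) l (by omega)
      have h2 := ih j (l + 1) (by omega)
      rw [show j + 1 + l = j + l + 1 by omega] at h1
      rw [← add_assoc] at h2
      rw [show j + 1 + (l + 1) = (j + l + 1) + 1 by omega, gaussBinom,
        Finset.prod_range_succ _ (j + l + 1), show j + l + 1 - j = l + 1 by omega]
      rw [Finset.prod_range_succ _ l] at h2 ⊢
      rw [Finset.prod_range_succ _ j] at h1 ⊢
      linear_combination (p ^ (l + 1) - 1) * h1 + p ^ (l + 1) * (p ^ (j + 1) - 1) * h2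

/-- The `q`-Chu–Vandermonde sum (in base `p`), cleared of denominators. -/
theorem sum_gaussBinom_mul {R : Type*} [CommRing R] (p b : R) (k : ℕ) (a : R) :
    ∑ j ∈ Finset.range (k + 1), gaussBinom p k j * (∏ i ∈ Finset.range j, -(b * p ^ i)) *
      (∏ i ∈ Finset.range j, (1 - a * p ^ i)) *
      (∏ i ∈ Finset.range (k - j), (1 - a * b * p ^ (j + i))) =
    ∏ i ∈ Finset.range k, (1 - b * p ^ i) := by
  induction k generalizing a with
  | zero => simp [gaussBinom]
  | succ k ih =>
    -- Pascal's recurrence splits the sum into the sums for `(a, k)` and for `(a * p, k)`.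
    have h1 : ∀ j ∈ Finset.range (k + 1),
        gaussBinom p k j * (∏ i ∈ Finset.range j, -(b * p ^ i)) *
          (∏ i ∈ Finset.range j, (1 - a * p ^ i)) *
          (∏ i ∈ Finset.range (k + 1 - j), (1 - a * b * p ^ (j + i))) =
        (gaussBinom p k j * (∏ i ∈ Finset.range j, -(b * p ^ i)) *
          (∏ i ∈ Finset.range j, (1 - a * p ^ i)) *
          (∏ i ∈ Finset.range (k - j), (1 - a * b * p ^ (j + i)))) * (1 - a * b * p ^ k) := by
      intro j hj
      rw [Finset.mem_range] at hj
      rw [show k + 1 - j = (k - j) + 1 by omega, Finset.prod_range_succ _ (k - j),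
        show j + (k - j) = k by omega]
      ring
    have h2 : ∀ j ∈ Finset.range (k + 1),
        p ^ (k - j) * gaussBinom p k j * (∏ i ∈ Finset.range (j + 1), -(b * p ^ i)) *
          (∏ i ∈ Finset.range (j + 1), (1 - a * p ^ i)) *
          (∏ i ∈ Finset.range (k + 1 - (j + 1)), (1 - a * b * p ^ (j + 1 + i))) =
        (gaussBinom p k j * (∏ i ∈ Finset.range j, -(b * p ^ i)) *
          (∏ i ∈ Finset.range j, (1 - a * p * p ^ i)) *
          (∏ i ∈ Finset.range (k - j), (1 - a * p * b * p ^ (j + i)))) *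
            (-(b * p ^ k) * (1 - a)) := by
      intro j hj
      rw [Finset.mem_range] at hj
      have e1 : ∏ i ∈ Finset.range (j + 1), (1 - a * p ^ i) =
          (∏ i ∈ Finset.range j, (1 - a * p * p ^ i)) * (1 - a) := by
        rw [Finset.prod_range_succ', pow_zero, mul_one]
        congr 1
        exact Finset.prod_congr rfl fun i _ => by ring
      have e2 : ∏ i ∈ Finset.range (k - j), (1 - a * b * p ^ (j + 1 + i)) =
          ∏ i ∈ Finset.range (k - j), (1 - a * p * b * p ^ (j + i)) :=
        Finset.prod_congr rfl fun i _ => by ring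
      have e3 : p ^ k = p ^ (k - j) * p ^ j := by rw [← pow_add]; congr 1; omega
      rw [Nat.add_sub_add_right, e1, e2, e3, Finset.prod_range_succ _ j]
      ring
    have h3 := Finset.sum_congr rfl h1
    have h4 := Finset.sum_congr rfl h2
    rw [← Finset.sum_mul, ih] at h3 h4
    rw [Finset.sum_range_succ']
    simp only [gaussBinom, add_mul, Finset.sum_add_distrib]
    rw [h4, add_right_comm, Finset.prod_range_succ _ k]
    rw [Finset.sum_range_succ', gaussBinom_zero_right] at h3
    rw [Finset.sum_range_succ, gaussBinom_of_lt p (Nat.lt_succ_self k)]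
    linear_combination h3

/-! ### Sums over subsets of an initial segment -/

/-- The generating function of the `l`-element subsets of `{1, …, m}`. -/
def subsetGenFun {R : Type*} [CommRing R] (q : R) (m l : ℕ) : R :=
  ∑ S ∈ Finset.powersetCard l (Finset.Icc 1 m), q ^ ∑ v ∈ S, v

theorem subsetGenFun_zero_right {R : Type*} [CommRing R] (q : R) (m : ℕ) :
    subsetGenFun q m 0 = 1 := by
  simp [subsetGenFun]

theorem subsetGenFun_succ {R : Type*} [CommRing R] (q : R) (m l : ℕ) :
    subsetGenFun q (m + 1) (l + 1) =
      subsetGenFun q m (l + 1) + q ^ (m + 1) * subsetGenFun q m l := by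
  have hm : m + 1 ∉ Finset.Icc 1 m := by simp
  have hI : Finset.Icc 1 (m + 1) = insert (m + 1) (Finset.Icc 1 m) := by
    ext v; simp only [Finset.mem_Icc, Finset.mem_insert]; omega
  have hnot : ∀ S ∈ Finset.powersetCard l (Finset.Icc 1 m), m + 1 ∉ S :=
    fun S hS h => hm ((Finset.mem_powersetCard.1 hS).1 h)
  rw [subsetGenFun, hI, Finset.powersetCard_succ_insert hm, Finset.sum_union, Finset.sum_image,
    subsetGenFun, subsetGenFun, Finset.mul_sum]
  · congr 1
    refine Finset.sum_congr rfl fun S hS => ?_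
    rw [Finset.sum_insert (hnot S hS), pow_add]
  · intro S hS T hT h
    rw [← Finset.erase_insert (hnot S hS), h, Finset.erase_insert (hnot T hT)]
  · rw [Finset.disjoint_left]
    intro S hS hS'
    obtain ⟨T, -, rfl⟩ := Finset.mem_image.1 hS'
    exact hm ((Finset.mem_powersetCard.1 hS).1 (Finset.mem_insert_self _ _))

/-- The product formula for `subsetGenFun`. It holds for `m < l` too, where both sides vanish. -/
theorem subsetGenFun_mul_prod {K : Type*} [Field K] {q : K} (hq : q ≠ 0) (m l : ℕ) :
    subsetGenFun q m l * ∏ i ∈ Finset.range l, (q⁻¹ ^ (i + 1) - 1) =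
      ∏ i ∈ Finset.range l, (1 - q ^ (m - i)) := by
  induction m generalizing l with
  | zero =>
    rcases l with _ | l
    · simp [subsetGenFun]
    · rw [Finset.prod_range_succ' (fun i => 1 - q ^ (0 - i)), subsetGenFun,
        Finset.powersetCard_eq_empty.2 (by simp)]
      simp
  | succ m ih =>
    rcases l with _ | l
    · simp [subsetGenFun]
    · have h1 := ih (l + 1)
      have h2 := ih l
      rw [Finset.prod_range_succ _ l] at h1 ⊢
      rw [Finset.prod_range_succ _ l] at h1
      rw [subsetGenFun_succ, Finset.prod_range_succ' _ l, Nat.sub_zero]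
      simp only [Nat.add_sub_add_right]
      rcases le_or_gt l m with hlm | hlm
      · have hqq : q ^ (m + 1) * q⁻¹ ^ (l + 1) = q ^ (m - l) := by
          rw [show m + 1 = (m - l) + (l + 1) by omega, pow_add, mul_assoc, ← mul_pow,
            mul_inv_cancel₀ hq, one_pow, mul_one]
        linear_combination h1 + q ^ (m + 1) * (q⁻¹ ^ (l + 1) - 1) * h2 +
          (∏ i ∈ Finset.range l, (1 - q ^ (m - i))) * hqq
      · -- For `m < l` both products contain the factor `1 - q ^ 0`.
        have hz : ∏ i ∈ Finset.range l, (1 - q ^ (m - i)) = 0 :=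
          Finset.prod_eq_zero (Finset.mem_range.2 hlm) (by simp)
        rw [hz] at h1 h2 ⊢
        linear_combination h1 + q ^ (m + 1) * (q⁻¹ ^ (l + 1) - 1) * h2

/-! ### Solving the lecture hall recurrence -/

theorem prod_inv_pow_sub_one_ne_zero {K : Type*} [Field K] {q : K}
    (hq1 : ∀ m, 0 < m → q ^ m ≠ 1) (l : ℕ) :
    ∏ i ∈ Finset.range l, (q⁻¹ ^ (i + 1) - 1) ≠ 0 := by
  refine Finset.prod_ne_zero_iff.2 fun i _ => sub_ne_zero.2 ?_
  rw [inv_pow, ne_eq, inv_eq_one]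
  exact hq1 _ i.succ_pos

/-- The counterpart of `[n choose k] [k choose j] = [n choose j] [n - j choose k - j]`. The base
of the Gaussian binomial is `q⁻¹`, which absorbs the powers of `q` separating the subset generating
functions from Gaussian binomials in base `q`. -/
theorem subsetGenFun_mul_subsetGenFun {K : Type*} [Field K] {q : K} (hq : q ≠ 0)
    (hq1 : ∀ m, 0 < m → q ^ m ≠ 1) {n k j : ℕ} (hj : j ≤ k) :
    subsetGenFun q (n - j) (k - j) * subsetGenFun q n j =
      subsetGenFun q n k * gaussBinom q⁻¹ k j := by
  obtain ⟨l, rfl⟩ := Nat.exists_eq_add_of_le hj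
  rw [Nat.add_sub_cancel_left]
  have h1 := subsetGenFun_mul_prod hq (n - j) l
  have h2 := subsetGenFun_mul_prod hq n j
  have h3 := subsetGenFun_mul_prod hq n (j + l)
  have h4 := gaussBinom_mul_prod q⁻¹ j l
  have h5 : ∏ i ∈ Finset.range (j + l), (1 - q ^ (n - i)) =
      (∏ i ∈ Finset.range j, (1 - q ^ (n - i))) * ∏ i ∈ Finset.range l, (1 - q ^ (n - j - i)) := by
    rw [Finset.prod_range_add]
    simp only [Nat.sub_sub]
  refine mul_right_cancel₀ (mul_ne_zero (prod_inv_pow_sub_one_ne_zero hq1 j)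
    (prod_inv_pow_sub_one_ne_zero hq1 l)) ?_
  calc _ = (subsetGenFun q (n - j) l * ∏ i ∈ Finset.range l, (q⁻¹ ^ (i + 1) - 1)) *
        (subsetGenFun q n j * ∏ i ∈ Finset.range j, (q⁻¹ ^ (i + 1) - 1)) := by ring
    _ = subsetGenFun q n (j + l) * ∏ i ∈ Finset.range (j + l), (q⁻¹ ^ (i + 1) - 1) := by
        rw [h1, h2, h3, h5]; ring
    _ = _ := by rw [← h4]; ring

theorem pow_mul_inv_pow_eq {K : Type*} [Field K] {q : K} (hq : q ≠ 0) {n i : ℕ} (hi : i ≤ n) :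
    q ^ n * q⁻¹ ^ i = q ^ (n - i) := by
  conv_lhs => rw [← Nat.sub_add_cancel hi, pow_add, mul_assoc, ← mul_pow, mul_inv_cancel₀ hq,
    one_pow, mul_one]

/-- The recurrence satisfied by the generating functions of the lecture hall partitions with
exactly `k` positive parts determines them, in closed form. -/
theorem closed_form_of_recurrence {K : Type*} [Field K] {q : K} (hq : q ≠ 0)
    (hq1 : ∀ m, 0 < m → q ^ m ≠ 1) {n : ℕ} {A : ℕ → K} (hA0 : A 0 = 1)
    (hA : ∀ k ≤ n, A k = ∑ j ∈ Finset.range (k + 1),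
      q ^ (∑ i ∈ Finset.range j, (n - i)) * subsetGenFun q (n - j) (k - j) * A j)
    {k : ℕ} (hk : k ≤ n) :
    A k * (∏ i ∈ Finset.range k, (q⁻¹ ^ (i + 1) - 1)) *
        (∏ i ∈ Finset.range k, (1 - q ^ (2 * n - i))) =
      ∏ i ∈ Finset.range k, (1 - q ^ (2 * (n - i))) := by
  set U : ℕ → K := fun j => ∏ i ∈ Finset.range j, (1 + q ^ (n - i)) with hU
  set V : ℕ → K := fun j => ∏ i ∈ Finset.range j, (1 - q ^ (2 * n - i)) with hV
  have hVne : ∀ j ≤ n, V j ≠ 0 := fun j hj =>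
    Finset.prod_ne_zero_iff.2 fun i hi => sub_ne_zero.2
      (hq1 _ (by rw [Finset.mem_range] at hi; omega)).symm
  have hUeq : ∀ j ≤ n, ∏ i ∈ Finset.range j, (1 - -(q ^ n) * q⁻¹ ^ i) = U j := fun j hj =>
    Finset.prod_congr rfl fun i hi => by
      rw [neg_mul, pow_mul_inv_pow_eq hq (by rw [Finset.mem_range] at hi; omega), sub_neg_eq_add]
  -- The candidate solution satisfies the recurrence, by the Chu–Vandermonde sum at
  -- `a = b = -q ^ n`.
  have hB : ∀ k ≤ n, subsetGenFun q n k * (U k / V k) = ∑ j ∈ Finset.range (k + 1),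
      q ^ (∑ i ∈ Finset.range j, (n - i)) * subsetGenFun q (n - j) (k - j) *
        (subsetGenFun q n j * (U j / V j)) := by
    intro k hk
    rw [← hUeq k hk, ← sum_gaussBinom_mul q⁻¹ (-(q ^ n)) k (-(q ^ n)), Finset.sum_div,
      Finset.mul_sum]
    refine Finset.sum_congr rfl fun j hj => ?_
    have hjk : j ≤ k := Nat.lt_succ_iff.1 (Finset.mem_range.1 hj)
    have e1 : ∏ i ∈ Finset.range j, -(-(q ^ n) * q⁻¹ ^ i) =
        q ^ ∑ i ∈ Finset.range j, (n - i) := by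
      rw [← Finset.prod_pow_eq_pow_sum]
      refine Finset.prod_congr rfl fun i hi => ?_
      rw [neg_mul, neg_neg, pow_mul_inv_pow_eq hq (by rw [Finset.mem_range] at hi; omega)]
    have e2 : V k = V j * ∏ i ∈ Finset.range (k - j),
        (1 - -(q ^ n) * -(q ^ n) * q⁻¹ ^ (j + i)) := by
      obtain ⟨l, rfl⟩ := Nat.exists_eq_add_of_le hjk
      rw [hV]
      simp only
      rw [Finset.prod_range_add, Nat.add_sub_cancel_left]
      congr 1
      refine Finset.prod_congr rfl fun i hi => ?_
      rw [Finset.mem_range] at hi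
      rw [neg_mul_neg, ← pow_add, ← two_mul, pow_mul_inv_pow_eq hq (by omega)]
    have hVk := hVne k hk
    have hVj := hVne j (hjk.trans hk)
    have e3 := subsetGenFun_mul_subsetGenFun hq hq1 (n := n) hjk
    rw [e1, hUeq j (hjk.trans hk)]
    rw [e2] at hVk ⊢
    have hW := right_ne_zero_of_mul hVk
    generalize ∏ i ∈ Finset.range (k - j), (1 - -(q ^ n) * -(q ^ n) * q⁻¹ ^ (j + i)) = W at hW ⊢
    calc _ = subsetGenFun q n k * gaussBinom q⁻¹ k j *
          (q ^ (∑ i ∈ Finset.range j, (n - i)) * (U j / V j)) := by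
          field_simp
      _ = _ := by rw [← e3]; ring
  have hAB : ∀ k ≤ n, A k = subsetGenFun q n k * (U k / V k) := by
    intro k
    induction k using Nat.strong_induction_on with
    | _ k ih =>
      intro hk
      rcases Nat.eq_zero_or_pos k with rfl | hpos
      · simp [hA0, subsetGenFun_zero_right, hU, hV]
      have h1 := hA k hk
      have h2 := hB k hk
      rw [Finset.sum_range_succ, Nat.sub_self, subsetGenFun_zero_right] at h1 h2
      rw [Finset.sum_congr rfl fun j hj => by
        rw [ih j (Finset.mem_range.1 hj) ((Finset.mem_range.1 hj).le.trans hk)]] at h1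
      have hs : 0 < ∑ i ∈ Finset.range k, (n - i) :=
        Finset.sum_pos (fun i hi => by rw [Finset.mem_range] at hi; omega)
          ⟨0, Finset.mem_range.2 hpos⟩
      -- The two recurrences differ only in their last terms, `q ^ s * A k` and its analogue.
      refine mul_right_cancel₀ (sub_ne_zero.2 (hq1 _ hs).symm) ?_
      linear_combination h1 - h2
  rw [hAB k hk, mul_right_comm _ (U k / V k), subsetGenFun_mul_prod hq, mul_assoc,
    div_mul_cancel₀ _ (hVne k hk), hU, ← Finset.prod_mul_distrib]
  exact Finset.prod_congr rfl fun i _ => by rw [pow_mul']; ring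

/-! ### Multisets with a bounded number of elements in a given set -/

/-- The multisets with elements in `P ∪ Q`, fewer than `b` of which (counted with multiplicity)
lie in `Q`. The strict bound makes the case `b = 0` empty, which starts the recurrence in `b`. -/
def boundedMultisets (P Q : Finset ℕ) (b : ℕ) : Set (Multiset ℕ) :=
  {s | (∀ x ∈ s, x ∈ P ∨ x ∈ Q) ∧ s.countP (· ∈ Q) < b}

theorem finite_multiset_sum_eq (N : ℕ) :
    ({s : Multiset ℕ | (∀ x ∈ s, 0 < x) ∧ s.sum = N}).Finite := by
  refine (Set.finite_range (fun p : Nat.Partition N => p.parts)).subset ?_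
  rintro s ⟨hs, hN⟩
  exact ⟨⟨s, fun {i} hi => hs i hi, hN⟩, rfl⟩

/-- Splitting a set of multisets of positive integers according to whether `x` occurs. -/
theorem weightGenFun_multiset_split (x : ℕ) {T : Set (Multiset ℕ)}
    (hT : ∀ s ∈ T, ∀ y ∈ s, 0 < y) :
    weightGenFun Multiset.sum T = weightGenFun Multiset.sum {s | s ∈ T ∧ x ∉ s} +
      PowerSeries.X ^ x * weightGenFun Multiset.sum {s | x ::ₘ s ∈ T} := by
  rw [weightGenFun_eq_sum (w := Multiset.sum) Finset.univ
    (fun i : Bool => if i then {s | x ::ₘ s ∈ T} else {s | s ∈ T ∧ x ∉ s}) T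
    (fun i s => if i then x ::ₘ s else s) (fun i => if i then x else 0)]
  · simp [add_comm]
  · exact fun N => (finite_multiset_sum_eq N).subset fun s hs => ⟨hT s hs.1, hs.2⟩
  · rintro (_ | _) - s hs
    · exact hs.1
    · exact hs
  · rintro (_ | _) - s -
    · simp
    · simp [add_comm]
  · rintro (_ | _) - (_ | _) - s hs t ht h
    · exact ⟨rfl, h⟩
    · exact absurd ((show s = x ::ₘ t from h) ▸ Multiset.mem_cons_self x t) hs.2
    · exact absurd ((show x ::ₘ s = t from h) ▸ Multiset.mem_cons_self x s) ht.2
    · exact ⟨rfl, (Multiset.cons_inj_right x).1 h⟩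
  · intro s hs
    by_cases hx : x ∈ s
    · obtain ⟨t, rfl⟩ := Multiset.exists_cons_of_mem hx
      exact ⟨true, Finset.mem_univ _, t, hs, rfl⟩
    · exact ⟨false, Finset.mem_univ _, s, ⟨hs, hx⟩, rfl⟩

theorem boundedMultisets_pos {P Q : Finset ℕ} (hP : 0 ∉ P) (hQ : 0 ∉ Q) (b : ℕ) :
    ∀ s ∈ boundedMultisets P Q b, ∀ y ∈ s, 0 < y := by
  rintro s ⟨hs, -⟩ y hy
  refine Nat.pos_of_ne_zero ?_
  rintro rfl
  exact (hs 0 hy).elim hP hQ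

/-- The generating function, by sum, of `boundedMultisets P Q b`. -/
noncomputable def boundedGenFun (P Q : Finset ℕ) (b : ℕ) : PowerSeries ℤ :=
  weightGenFun Multiset.sum (boundedMultisets P Q b)

theorem boundedGenFun_insert_left {P Q : Finset ℕ} (hP : 0 ∉ P) (hQ : 0 ∉ Q) {x : ℕ} (hx : 0 < x)
    (hxP : x ∉ P) (hxQ : x ∉ Q) (b : ℕ) :
    (1 - PowerSeries.X ^ x) * boundedGenFun (insert x P) Q b = boundedGenFun P Q b := by
  have h := weightGenFun_multiset_split x
    (boundedMultisets_pos (P := insert x P) (Q := Q) (b := b) (by simp [hx.ne, hP]) hQ)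
  have h1 : {s | s ∈ boundedMultisets (insert x P) Q b ∧ x ∉ s} = boundedMultisets P Q b := by
    ext s
    constructor
    · rintro ⟨⟨h1, h2⟩, h3⟩
      refine ⟨fun y hy => ?_, h2⟩
      have hne : y ≠ x := fun e => h3 (e ▸ hy)
      simpa [hne] using h1 y hy
    · rintro ⟨h1, h2⟩
      exact ⟨⟨fun y hy => (h1 y hy).imp_left fun h => Finset.mem_insert_of_mem h, h2⟩,
        fun h => (h1 x h).elim hxP hxQ⟩
  have h2 : {s | x ::ₘ s ∈ boundedMultisets (insert x P) Q b} =
      boundedMultisets (insert x P) Q b := by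
    ext s
    simp [boundedMultisets, hxQ]
  rw [h1, h2] at h
  unfold boundedGenFun
  linear_combination h

theorem boundedGenFun_insert_right {P Q : Finset ℕ} (hP : 0 ∉ P) (hQ : 0 ∉ Q) {x : ℕ} (hx : 0 < x)
    (hxP : x ∉ P) (hxQ : x ∉ Q) (b : ℕ) :
    boundedGenFun P (insert x Q) (b + 1) =
      boundedGenFun P Q (b + 1) + PowerSeries.X ^ x * boundedGenFun P (insert x Q) b := by
  have h := weightGenFun_multiset_split x
    (boundedMultisets_pos (P := P) (Q := insert x Q) (b := b + 1) hP (by simp [hx.ne, hQ]))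
  have hcount : ∀ s : Multiset ℕ, x ∉ s → s.countP (· ∈ insert x Q) = s.countP (· ∈ Q) := by
    intro s hs
    refine Multiset.countP_congr rfl fun y hy => ?_
    have hne : y ≠ x := fun e => hs (e ▸ hy)
    simp [hne]
  have h1 : {s | s ∈ boundedMultisets P (insert x Q) (b + 1) ∧ x ∉ s} =
      boundedMultisets P Q (b + 1) := by
    ext s
    constructor
    · rintro ⟨⟨h1, h2⟩, h3⟩
      refine ⟨fun y hy => ?_, hcount s h3 ▸ h2⟩
      have hne : y ≠ x := fun e => h3 (e ▸ hy)
      simpa [hne] using h1 y hy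
    · rintro ⟨h1, h2⟩
      have h3 : x ∉ s := fun h => (h1 x h).elim hxP hxQ
      exact ⟨⟨fun y hy => (h1 y hy).imp_right fun h => Finset.mem_insert_of_mem h,
        (hcount s h3).symm ▸ h2⟩, h3⟩
  have h2 : {s | x ::ₘ s ∈ boundedMultisets P (insert x Q) (b + 1)} =
      boundedMultisets P (insert x Q) b := by
    ext s
    simp [boundedMultisets]
  rw [h1, h2] at h
  exact h

theorem boundedGenFun_zero (P Q : Finset ℕ) : boundedGenFun P Q 0 = 0 := by
  ext N
  simp [boundedGenFun, weightGenFun, boundedMultisets]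

theorem prod_mul_boundedGenFun_empty {P : Finset ℕ} (hP : 0 ∉ P) (b : ℕ) :
    (∏ x ∈ P, (1 - PowerSeries.X ^ x)) * boundedGenFun P ∅ (b + 1) = 1 := by
  induction P using Finset.induction_on with
  | empty =>
    have h0 : boundedMultisets ∅ ∅ (b + 1) = {0} := by
      ext s
      constructor
      · rintro ⟨h, -⟩
        exact Multiset.eq_zero_of_forall_notMem fun x hx => by simpa using h x hx
      · rintro rfl
        exact ⟨by simp, by simp⟩
    ext N
    rw [Finset.prod_empty, one_mul, boundedGenFun, weightGenFun, PowerSeries.coeff_mk,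
      PowerSeries.coeff_one, h0]
    split_ifs with hN
    · rw [Nat.cast_eq_one, Set.ncard_eq_one]
      refine ⟨0, Set.ext fun f => ?_⟩
      constructor
      · exact fun h => h.1
      · rintro rfl
        exact ⟨rfl, by simp [hN]⟩
    · rw [Nat.cast_eq_zero]
      convert Set.ncard_empty (Multiset ℕ)
      ext f
      simp only [Set.mem_empty_iff_false, iff_false]
      rintro ⟨rfl, h⟩
      exact hN (by simpa using h.symm)
  | insert x P hx ih =>
    simp only [Finset.mem_insert, not_or] at hP
    rw [Finset.prod_insert hx, mul_comm (1 - _), mul_assoc,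
      boundedGenFun_insert_left hP.2 (by simp) (Nat.pos_of_ne_zero (Ne.symm hP.1)) hx (by simp),
      ih hP.2]

/-- The generating function of the multisets with elements in `P ∪ Q`, exactly `c` of them
in `Q`. -/
noncomputable def exactGenFun (P Q : Finset ℕ) (c : ℕ) : PowerSeries ℤ :=
  boundedGenFun P Q (c + 1) - boundedGenFun P Q c

theorem exactGenFun_insert_zero {P Q : Finset ℕ} (hP : 0 ∉ P) (hQ : 0 ∉ Q) {x : ℕ} (hx : 0 < x)
    (hxP : x ∉ P) (hxQ : x ∉ Q) :
    exactGenFun P (insert x Q) 0 = exactGenFun P Q 0 := by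
  simp [exactGenFun, boundedGenFun_zero, boundedGenFun_insert_right hP hQ hx hxP hxQ]

theorem exactGenFun_insert_succ {P Q : Finset ℕ} (hP : 0 ∉ P) (hQ : 0 ∉ Q) {x : ℕ} (hx : 0 < x)
    (hxP : x ∉ P) (hxQ : x ∉ Q) (c : ℕ) :
    exactGenFun P (insert x Q) (c + 1) =
      exactGenFun P Q (c + 1) + PowerSeries.X ^ x * exactGenFun P (insert x Q) c := by
  unfold exactGenFun
  linear_combination boundedGenFun_insert_right hP hQ hx hxP hxQ (c + 1) -
    boundedGenFun_insert_right hP hQ hx hxP hxQ c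

/-- The set of odd numbers `2 * i + 1` with `i ∈ S`. -/
def oddNumbers (S : Finset ℕ) : Finset ℕ := S.image fun i => 2 * i + 1

theorem mem_oddNumbers {S : Finset ℕ} {x : ℕ} : x ∈ oddNumbers S ↔ ∃ i ∈ S, 2 * i + 1 = x :=
  Finset.mem_image

theorem mem_oddNumbers_self {S : Finset ℕ} {i : ℕ} : 2 * i + 1 ∈ oddNumbers S ↔ i ∈ S := by
  simp [mem_oddNumbers]

theorem zero_notMem_oddNumbers (S : Finset ℕ) : 0 ∉ oddNumbers S := by
  simp [mem_oddNumbers]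

theorem oddNumbers_insert (i : ℕ) (S : Finset ℕ) :
    oddNumbers (insert i S) = insert (2 * i + 1) (oddNumbers S) :=
  Finset.image_insert _ _ _

theorem prod_oddNumbers {M : Type*} [CommMonoid M] (S : Finset ℕ) (f : ℕ → M) :
    ∏ x ∈ oddNumbers S, f x = ∏ i ∈ S, f (2 * i + 1) :=
  Finset.prod_image fun i _ j _ h => by simpa using h

/-- For `m` consecutive odd numbers the complete homogeneous sum of degree `c` is a Gaussian
binomial in base `X ^ 2`. -/
theorem exactGenFun_oddNumbers {S : Finset ℕ} {a : ℕ} (m c : ℕ)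
    (hS : ∀ i ∈ S, i < a ∨ a + m ≤ i) :
    exactGenFun (oddNumbers S) (oddNumbers (Finset.Ico a (a + m))) c *
        (∏ i ∈ S, (1 - PowerSeries.X ^ (2 * i + 1))) *
        (∏ i ∈ Finset.range c, (1 - PowerSeries.X ^ (2 * (i + 1)))) =
      PowerSeries.X ^ ((2 * a + 1) * c) *
        ∏ i ∈ Finset.range c, (1 - PowerSeries.X ^ (2 * (m + i))) := by
  have h0 := zero_notMem_oddNumbers
  induction m generalizing c with
  | zero =>
    have hempty := prod_mul_boundedGenFun_empty (h0 S)
    rw [prod_oddNumbers] at hempty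
    rcases c with _ | c
    · have := hempty 0
      simp only [zero_add] at this
      simpa [exactGenFun, oddNumbers, boundedGenFun_zero, mul_comm] using this
    · have h1 := hempty c
      have h2 := hempty (c + 1)
      rw [Finset.prod_range_succ' (fun i => 1 - PowerSeries.X ^ (2 * (0 + i))), add_zero,
        Finset.Ico_self, add_zero, mul_zero, pow_zero, sub_self, mul_zero, mul_zero, exactGenFun]
      rw [show oddNumbers ∅ = ∅ from Finset.image_empty _]
      linear_combination (∏ i ∈ Finset.range (c + 1), (1 - PowerSeries.X ^ (2 * (i + 1)))) *
        (h2 - h1)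
  | succ m ihm =>
    have hI : Finset.Ico a (a + (m + 1)) = insert (a + m) (Finset.Ico a (a + m)) := by
      ext i; simp only [Finset.mem_Ico, Finset.mem_insert]; omega
    have hxP : 2 * (a + m) + 1 ∉ oddNumbers S := by
      rw [mem_oddNumbers_self]
      intro h
      have := hS _ h
      omega
    have hxQ : 2 * (a + m) + 1 ∉ oddNumbers (Finset.Ico a (a + m)) := by
      simp [mem_oddNumbers_self]
    have hS' : ∀ i ∈ S, i < a ∨ a + m ≤ i := fun i hi => (hS i hi).imp_right (by omega)
    rw [hI, oddNumbers_insert]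
    induction c with
    | zero =>
      rw [exactGenFun_insert_zero (h0 S) (h0 _) (by omega) hxP hxQ, ihm 0 hS']
      simp
    | succ c ihc =>
      have h1 := ihm (c + 1) hS'
      rw [exactGenFun_insert_succ (h0 S) (h0 _) (by omega) hxP hxQ]
      rw [Finset.prod_range_succ' (fun i => 1 - PowerSeries.X ^ (2 * (m + i)))] at h1
      rw [Finset.prod_range_succ (fun i => 1 - PowerSeries.X ^ (2 * (m + 1 + i)))]
      have h2 : ∏ i ∈ Finset.range c, (1 - (PowerSeries.X : PowerSeries ℤ) ^ (2 * (m + (i + 1)))) =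
          ∏ i ∈ Finset.range c, (1 - PowerSeries.X ^ (2 * (m + 1 + i))) :=
        Finset.prod_congr rfl fun i _ => by ring
      rw [h2] at h1
      rw [Finset.prod_range_succ] at h1 ⊢
      linear_combination h1 + PowerSeries.X ^ (2 * (a + m) + 1) *
        (1 - PowerSeries.X ^ (2 * (c + 1))) * ihc

/-! ### Increments in the number of parts -/

/-- The generating function of the partitions into odd parts less than `2 * n` with at most
`⌊k / 2⌋` parts in `{2⌈k/2⌉ + 1, …, 2(n - ⌊k/2⌋) - 1}`. -/
noncomputable def restrictedOddGenFun (n k : ℕ) : PowerSeries ℤ :=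
  boundedGenFun (oddNumbers (Finset.range ((k + 1) / 2) ∪ Finset.Ico (n - k / 2) n))
    (oddNumbers (Finset.Ico ((k + 1) / 2) (n - k / 2))) (k / 2 + 1)

theorem restrictedOddGenFun_zero (n : ℕ) : restrictedOddGenFun n 0 = 1 := by
  have h := exactGenFun_oddNumbers (S := ∅) (a := 0) n 0 (by simp)
  simp only [exactGenFun, boundedGenFun_zero] at h
  simpa [restrictedOddGenFun] using h

/-- Making `x` unrestricted while raising the bound by one. -/
theorem boundedGenFun_sub_of_bound_succ {P Q : Finset ℕ} (hP : 0 ∉ P) (hQ : 0 ∉ Q) {x : ℕ}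
    (hx : 0 < x) (hxP : x ∉ P) (hxQ : x ∉ Q) (c : ℕ) :
    (boundedGenFun (insert x P) Q (c + 1) - boundedGenFun P (insert x Q) c) *
      (1 - PowerSeries.X ^ x) = exactGenFun P (insert x Q) c := by
  have h1 := boundedGenFun_insert_left hP hQ hx hxP hxQ (c + 1)
  have h2 := boundedGenFun_insert_right hP hQ hx hxP hxQ c
  rw [exactGenFun]
  linear_combination h1 - h2

/-- Making `x` unrestricted while keeping the bound. -/
theorem boundedGenFun_sub_of_bound_eq {P Q : Finset ℕ} (hP : 0 ∉ P) (hQ : 0 ∉ Q) {x : ℕ}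
    (hx : 0 < x) (hxP : x ∉ P) (hxQ : x ∉ Q) (c : ℕ) :
    (boundedGenFun (insert x P) Q (c + 1) - boundedGenFun P (insert x Q) (c + 1)) *
      (1 - PowerSeries.X ^ x) = PowerSeries.X ^ x * exactGenFun P (insert x Q) c := by
  have h1 := boundedGenFun_insert_left hP hQ hx hxP hxQ (c + 1)
  have h2 := boundedGenFun_insert_right hP hQ hx hxP hxQ c
  rw [exactGenFun]
  linear_combination h1 - h2

theorem prod_range_two_mul {M : Type*} [CommMonoid M] (f : ℕ → M) (c : ℕ) :
    ∏ i ∈ Finset.range (2 * c), f i =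
      (∏ i ∈ Finset.range c, f (2 * i)) * ∏ i ∈ Finset.range c, f (2 * i + 1) := by
  induction c with
  | zero => simp
  | succ c ih =>
    rw [show 2 * (c + 1) = 2 * c + 1 + 1 by ring, Finset.prod_range_succ, Finset.prod_range_succ,
      ih, Finset.prod_range_succ, Finset.prod_range_succ, mul_assoc, mul_mul_mul_comm]

theorem sum_range_two_mul_succ (c : ℕ) :
    ∑ i ∈ Finset.range (2 * c), (i + 1) = (2 * c + 1) * c := by
  induction c with
  | zero => simp
  | succ c ih =>
    rw [show 2 * (c + 1) = 2 * c + 1 + 1 by ring, Finset.sum_range_succ, Finset.sum_range_succ, ih]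
    ring

theorem one_sub_X_pow_ne_zero {m : ℕ} (hm : 0 < m) :
    (1 - PowerSeries.X ^ m : PowerSeries ℤ) ≠ 0 := by
  intro h
  have := congrArg PowerSeries.constantCoeff h
  simp [hm.ne'] at this

theorem prod_Ico_sub_eq {M : Type*} [CommMonoid M] (f : ℕ → M) {n c : ℕ} (hc : c ≤ n) :
    ∏ i ∈ Finset.Ico (n - c) n, f i = ∏ i ∈ Finset.range c, f (n - 1 - i) := by
  rw [Finset.prod_Ico_eq_prod_range, show n - (n - c) = c by omega, ← Finset.prod_range_reflect]
  refine Finset.prod_congr rfl fun i hi => ?_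
  rw [Finset.mem_range] at hi
  congr 1
  omega

/-- For even `k` the number `2 * (n - k / 2) + 1` becomes unrestricted, and the bound is raised. -/
theorem restrictedOddGenFun_sub_even {n c : ℕ} (hc : 0 < c) (hn : 2 * c ≤ n) :
    (restrictedOddGenFun n (2 * c) - restrictedOddGenFun n (2 * c - 1)) *
        (∏ i ∈ Finset.range (2 * c), (1 - PowerSeries.X ^ (i + 1))) *
        (∏ i ∈ Finset.range (2 * c), (1 - PowerSeries.X ^ (2 * n - i))) =
      PowerSeries.X ^ (∑ i ∈ Finset.range (2 * c), (i + 1)) *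
        ∏ i ∈ Finset.range (2 * c), (1 - PowerSeries.X ^ (2 * (n - i))) := by
  set P := Finset.range c ∪ Finset.Ico (n - c + 1) n with hPdef
  have hP1 : Finset.range c ∪ Finset.Ico (n - c) n = insert (n - c) P := by
    ext i; simp only [hPdef, Finset.mem_union, Finset.mem_range, Finset.mem_Ico,
      Finset.mem_insert]; omega
  have hQ1 : Finset.Ico c (c + (n - 2 * c + 1)) = insert (n - c) (Finset.Ico c (n - c)) := by
    ext i; simp only [Finset.mem_Ico, Finset.mem_insert]; omega
  have hxP : n - c ∉ P := by
    simp only [hPdef, Finset.mem_union, Finset.mem_range, Finset.mem_Ico]; omega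
  have hdiff : (restrictedOddGenFun n (2 * c) - restrictedOddGenFun n (2 * c - 1)) *
      (1 - PowerSeries.X ^ (2 * (n - c) + 1)) =
      exactGenFun (oddNumbers P) (oddNumbers (Finset.Ico c (c + (n - 2 * c + 1)))) c := by
    rw [hQ1, oddNumbers_insert, ← boundedGenFun_sub_of_bound_succ (zero_notMem_oddNumbers _)
      (zero_notMem_oddNumbers _) (by omega) (by rwa [mem_oddNumbers_self])
      (by simp [mem_oddNumbers_self]) c, ← oddNumbers_insert, ← oddNumbers_insert, ← hQ1, ← hP1,
      restrictedOddGenFun, restrictedOddGenFun, show (2 * c + 1) / 2 = c by omega,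
      show 2 * c / 2 = c by omega, show (2 * c - 1 + 1) / 2 = c by omega,
      show (2 * c - 1) / 2 + 1 = c by omega, show n - (2 * c - 1) / 2 = n - c + 1 by omega,
      show c + (n - 2 * c + 1) = n - c + 1 by omega]
  have hclosed := exactGenFun_oddNumbers (S := P) (a := c) (n - 2 * c + 1) c (by
    intro i hi
    simp only [hPdef, Finset.mem_union, Finset.mem_range, Finset.mem_Ico] at hi
    omega)
  have hprod : (1 - (PowerSeries.X : PowerSeries ℤ) ^ (2 * (n - c) + 1)) *
      ∏ i ∈ P, (1 - PowerSeries.X ^ (2 * i + 1)) =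
      (∏ i ∈ Finset.range c, (1 - PowerSeries.X ^ (2 * i + 1))) *
        ∏ i ∈ Finset.range c, (1 - PowerSeries.X ^ (2 * n - (2 * i + 1))) := by
    rw [← Finset.prod_insert (f := fun i => 1 - (PowerSeries.X : PowerSeries ℤ) ^ (2 * i + 1)) hxP,
      ← hP1, Finset.prod_union, prod_Ico_sub_eq _ (by omega)]
    · congr 1
      refine Finset.prod_congr rfl fun i hi => ?_
      rw [Finset.mem_range] at hi
      rw [show 2 * (n - 1 - i) + 1 = 2 * n - (2 * i + 1) by omega]
    · rw [Finset.disjoint_left]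
      intro i hi hi'
      rw [Finset.mem_range] at hi
      rw [Finset.mem_Ico] at hi'
      omega
  have hrefl : ∏ i ∈ Finset.range c, (1 - (PowerSeries.X : PowerSeries ℤ) ^ (2 * (n - 2 * c + 1 + i)))
      = ∏ i ∈ Finset.range c, (1 - PowerSeries.X ^ (2 * (n - (c + i)))) := by
    rw [← Finset.prod_range_reflect]
    refine Finset.prod_congr rfl fun i hi => ?_
    rw [Finset.mem_range] at hi
    rw [show n - 2 * c + 1 + (c - 1 - i) = n - (c + i) by omega]
  rw [prod_range_two_mul (fun i => 1 - PowerSeries.X ^ (i + 1)),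
    prod_range_two_mul (fun i => 1 - PowerSeries.X ^ (2 * n - i)), sum_range_two_mul_succ,
    two_mul c, Finset.prod_range_add (fun i => 1 - PowerSeries.X ^ (2 * (n - i)))]
  simp only [← two_mul]
  rw [← hdiff, hrefl] at hclosed
  simp only [← Nat.mul_sub, show ∀ i, 2 * i + 1 + 1 = 2 * (i + 1) from fun i => by ring]
  linear_combination (∏ i ∈ Finset.range c, (1 - PowerSeries.X ^ (2 * (n - i)))) * hclosed -
    (∏ i ∈ Finset.range c, (1 - PowerSeries.X ^ (2 * (n - i)))) *
    (∏ i ∈ Finset.range c, (1 - PowerSeries.X ^ (2 * (i + 1)))) *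
    (restrictedOddGenFun n (2 * c) - restrictedOddGenFun n (2 * c - 1)) * hprod

/-- For odd `k` the number `k` becomes unrestricted, and the bound stays the same. -/
theorem restrictedOddGenFun_sub_odd {n c : ℕ} (hn : 2 * c + 1 ≤ n) :
    (restrictedOddGenFun n (2 * c + 1) - restrictedOddGenFun n (2 * c)) *
        (∏ i ∈ Finset.range (2 * c + 1), (1 - PowerSeries.X ^ (i + 1))) *
        (∏ i ∈ Finset.range (2 * c + 1), (1 - PowerSeries.X ^ (2 * n - i))) =
      PowerSeries.X ^ (∑ i ∈ Finset.range (2 * c + 1), (i + 1)) *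
        ∏ i ∈ Finset.range (2 * c + 1), (1 - PowerSeries.X ^ (2 * (n - i))) := by
  set P := Finset.range c ∪ Finset.Ico (n - c) n with hPdef
  have hP1 : Finset.range (c + 1) ∪ Finset.Ico (n - c) n = insert c P := by
    rw [hPdef, Finset.range_add_one, Finset.insert_union]
  have hQ1 : Finset.Ico c (c + (n - 2 * c)) = insert c (Finset.Ico (c + 1) (n - c)) := by
    ext i; simp only [Finset.mem_Ico, Finset.mem_insert]; omega
  have hxP : c ∉ P := by
    simp only [hPdef, Finset.mem_union, Finset.mem_range, Finset.mem_Ico]; omega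
  have hdiff : (restrictedOddGenFun n (2 * c + 1) - restrictedOddGenFun n (2 * c)) *
      (1 - PowerSeries.X ^ (2 * c + 1)) = PowerSeries.X ^ (2 * c + 1) *
      exactGenFun (oddNumbers P) (oddNumbers (Finset.Ico c (c + (n - 2 * c)))) c := by
    rw [hQ1, oddNumbers_insert, ← boundedGenFun_sub_of_bound_eq (zero_notMem_oddNumbers _)
      (zero_notMem_oddNumbers _) (by omega) (by rwa [mem_oddNumbers_self])
      (by simp [mem_oddNumbers_self]) c, ← oddNumbers_insert, ← oddNumbers_insert, ← hQ1, ← hP1,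
      restrictedOddGenFun, restrictedOddGenFun, show (2 * c + 1 + 1) / 2 = c + 1 by omega,
      show (2 * c + 1) / 2 = c by omega, show 2 * c / 2 = c by omega,
      show c + (n - 2 * c) = n - c by omega]
  have hclosed := exactGenFun_oddNumbers (S := P) (a := c) (n - 2 * c) c (by
    intro i hi
    simp only [hPdef, Finset.mem_union, Finset.mem_range, Finset.mem_Ico] at hi
    omega)
  have hprod : ∏ i ∈ P, (1 - (PowerSeries.X : PowerSeries ℤ) ^ (2 * i + 1)) =
      (∏ i ∈ Finset.range c, (1 - PowerSeries.X ^ (2 * i + 1))) *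
        ∏ i ∈ Finset.range c, (1 - PowerSeries.X ^ (2 * n - (2 * i + 1))) := by
    rw [hPdef, Finset.prod_union, prod_Ico_sub_eq _ (by omega)]
    · congr 1
      refine Finset.prod_congr rfl fun i hi => ?_
      rw [Finset.mem_range] at hi
      rw [show 2 * (n - 1 - i) + 1 = 2 * n - (2 * i + 1) by omega]
    · rw [Finset.disjoint_left]
      intro i hi hi'
      rw [Finset.mem_range] at hi
      rw [Finset.mem_Ico] at hi'
      omega
  have hrefl : ∏ i ∈ Finset.range c, (1 - (PowerSeries.X : PowerSeries ℤ) ^ (2 * (n - 2 * c + i)))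
      = ∏ i ∈ Finset.range c, (1 - PowerSeries.X ^ (2 * (n - (c + 1 + i)))) := by
    rw [← Finset.prod_range_reflect]
    refine Finset.prod_congr rfl fun i hi => ?_
    rw [Finset.mem_range] at hi
    rw [show n - 2 * c + (c - 1 - i) = n - (c + 1 + i) by omega]
  rw [Finset.prod_range_succ, Finset.prod_range_succ (fun i => 1 - PowerSeries.X ^ (2 * n - i)),
    Finset.sum_range_succ, prod_range_two_mul (fun i => 1 - PowerSeries.X ^ (i + 1)),
    prod_range_two_mul (fun i => 1 - PowerSeries.X ^ (2 * n - i)), sum_range_two_mul_succ,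
    show Finset.range (2 * c + 1) = Finset.range (c + 1 + c) by congr 1; ring,
    Finset.prod_range_add (fun i => 1 - PowerSeries.X ^ (2 * (n - i))), Finset.prod_range_succ,
    pow_add]
  rw [hrefl, hprod] at hclosed
  simp only [← Nat.mul_sub, show ∀ i, 2 * i + 1 + 1 = 2 * (i + 1) from fun i => by ring]
  linear_combination (∏ i ∈ Finset.range c, (1 - PowerSeries.X ^ (2 * (n - i)))) *
      (1 - PowerSeries.X ^ (2 * (n - c))) * PowerSeries.X ^ (2 * c + 1) * hclosed +
    (∏ i ∈ Finset.range c, (1 - PowerSeries.X ^ (2 * (n - i)))) *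
    (1 - PowerSeries.X ^ (2 * (n - c))) *
    (∏ i ∈ Finset.range c, (1 - PowerSeries.X ^ (2 * (i + 1)))) *
    (∏ i ∈ Finset.range c, (1 - PowerSeries.X ^ (2 * i + 1))) *
    (∏ i ∈ Finset.range c, (1 - PowerSeries.X ^ (2 * n - (2 * i + 1)))) * hdiff

/-- The increments of the partition generating functions have the closed form of the generating
function of lecture hall partitions with exactly `k` positive parts. -/
theorem restrictedOddGenFun_sub {n k : ℕ} (hk : 0 < k) (hkn : k ≤ n) :
    (restrictedOddGenFun n k - restrictedOddGenFun n (k - 1)) *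
        (∏ i ∈ Finset.range k, (1 - PowerSeries.X ^ (i + 1))) *
        (∏ i ∈ Finset.range k, (1 - PowerSeries.X ^ (2 * n - i))) =
      PowerSeries.X ^ (∑ i ∈ Finset.range k, (i + 1)) *
        ∏ i ∈ Finset.range k, (1 - PowerSeries.X ^ (2 * (n - i))) := by
  obtain ⟨c, rfl | rfl⟩ := Nat.even_or_odd' k
  · exact restrictedOddGenFun_sub_even (by omega) hkn
  · exact restrictedOddGenFun_sub_odd hkn

/-! ### Comparison of the two families -/

theorem posLectureHallSeq_closed_form {n k : ℕ} (hk : k ≤ n) :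
    weightGenFun (fun f => ∑ i ∈ Finset.range n, f i) (posLectureHallSeq n k) *
        (∏ i ∈ Finset.range k, (1 - PowerSeries.X ^ (i + 1))) *
        (∏ i ∈ Finset.range k, (1 - PowerSeries.X ^ (2 * n - i))) =
      PowerSeries.X ^ (∑ i ∈ Finset.range k, (i + 1)) *
        ∏ i ∈ Finset.range k, (1 - PowerSeries.X ^ (2 * (n - i))) := by
  -- The recurrence is solved in a field, where `q⁻¹` is available.
  set φ := algebraMap (PowerSeries ℤ) (FractionRing (PowerSeries ℤ))
  have hφ : Function.Injective φ := IsFractionRing.injective _ _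
  set q := φ PowerSeries.X with hq
  have hq0 : q ≠ 0 := (map_ne_zero_iff φ hφ).2 PowerSeries.X_ne_zero
  have hq1 : ∀ m, 0 < m → q ^ m ≠ 1 := by
    intro m hm h
    refine one_sub_X_pow_ne_zero hm (hφ ?_)
    rw [map_sub, map_pow, map_one, map_zero, ← hq, h, sub_self]
  have h := closed_form_of_recurrence hq0 hq1 (n := n) (A := fun k => φ (weightGenFun
    (fun f => ∑ i ∈ Finset.range n, f i) (posLectureHallSeq n k)))
    (by simp only [weightGenFun_posLectureHallSeq_zero, map_one])
    (fun k hk => by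
      simp only [weightGenFun_posLectureHallSeq n k hk, map_sum, map_mul, map_pow, subsetGenFun,
        ← hq]) hk
  have hclear : (∏ i ∈ Finset.range k, (q⁻¹ ^ (i + 1) - 1)) * q ^ ∑ i ∈ Finset.range k, (i + 1) =
      ∏ i ∈ Finset.range k, (1 - q ^ (i + 1)) := by
    rw [← Finset.prod_pow_eq_pow_sum, ← Finset.prod_mul_distrib]
    refine Finset.prod_congr rfl fun i _ => ?_
    rw [sub_mul, ← mul_pow, inv_mul_cancel₀ hq0, one_pow, one_mul]
  refine hφ ?_
  simp only [map_mul, map_prod, map_sub, map_one, map_pow, ← hq]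
  rw [← hclear, ← h]
  ring

theorem weightGenFun_lectureHallSeq_eq {n k : ℕ} (hk : k ≤ n) :
    weightGenFun (fun f => ∑ i ∈ Finset.range n, f i) (lectureHallSeq n k) =
      restrictedOddGenFun n k := by
  rw [weightGenFun_lectureHallSeq n k hk]
  induction k with
  | zero => simp [weightGenFun_posLectureHallSeq_zero, restrictedOddGenFun_zero]
  | succ k ih =>
    have h1 := posLectureHallSeq_closed_form hk
    have h2 := restrictedOddGenFun_sub k.succ_pos hk
    rw [Nat.succ_sub_one] at h2
    have hne1 : ∏ i ∈ Finset.range (k + 1), (1 - (PowerSeries.X : PowerSeries ℤ) ^ (i + 1)) ≠ 0 :=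
      Finset.prod_ne_zero_iff.2 fun i _ => one_sub_X_pow_ne_zero i.succ_pos
    have hne2 :
        ∏ i ∈ Finset.range (k + 1), (1 - (PowerSeries.X : PowerSeries ℤ) ^ (2 * n - i)) ≠ 0 :=
      Finset.prod_ne_zero_iff.2 fun i hi =>
        one_sub_X_pow_ne_zero (by rw [Finset.mem_range] at hi; omega)
    have h3 := mul_right_cancel₀ hne1 (mul_right_cancel₀ hne2 (h1.trans h2.symm))
    rw [Finset.sum_range_succ, ih (by omega), h3]
    ring

/-- The extension by zeros of a sequence of length `k` to a sequence indexed by `ℕ`. -/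
def extendZero {k : ℕ} (l : Fin k → ℕ) (i : ℕ) : ℕ := if h : i < k then l ⟨i, h⟩ else 0

theorem extendZero_injective (k : ℕ) : Function.Injective (extendZero (k := k)) := by
  intro l l' h
  funext i
  simpa [extendZero] using congrFun h i

theorem sum_extendZero {n k : ℕ} (hk : k ≤ n) (l : Fin k → ℕ) :
    ∑ i ∈ Finset.range n, extendZero l i = ∑ i, l i := by
  rw [← Finset.sum_subset (Finset.range_mono hk) (fun i _ hi => dif_neg (by simpa using hi)),
    Finset.sum_range]
  exact Finset.sum_congr rfl fun i _ => by simp [extendZero]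

theorem extendZero_mem_lectureHallSeq {n k : ℕ} (hk : k ≤ n) (l : Fin k → ℕ) :
    extendZero l ∈ lectureHallSeq n k ↔ l ∈ truncatedLectureHall n k := by
  -- Clearing the (positive) denominators.
  have hdiv : ∀ i (hi : i + 1 < k), (l ⟨i + 1, hi⟩ : ℚ) / ((n : ℚ) - ((i + 1 : ℕ) : ℚ)) ≤
      (l ⟨i, by omega⟩ : ℚ) / ((n : ℚ) - (i : ℚ)) ↔
      l ⟨i + 1, hi⟩ * (n - i) ≤ l ⟨i, by omega⟩ * (n - (i + 1)) := by
    intro i hi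
    rw [← Nat.cast_sub (by omega), ← Nat.cast_sub (by omega),
      div_le_div_iff₀ (by exact_mod_cast (by omega)) (by exact_mod_cast (by omega))]
    exact_mod_cast Iff.rfl
  constructor
  · rintro ⟨h, -⟩
    have hstep : ∀ i (hi : i + 1 < k),
        l ⟨i + 1, hi⟩ * (n - i) ≤ l ⟨i, by omega⟩ * (n - (i + 1)) := by
      intro i hi
      simpa [extendZero, hi, show i < k by omega] using h i
    refine ⟨?_, ?_, ?_⟩
    · have hanti : Antitone (extendZero l) := by
        refine antitone_nat_of_succ_le fun i => ?_
        rcases lt_or_ge (i + 1) k with hi | hi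
        · have h1 := h i
          have h2 : 0 < n - i := by omega
          refine Nat.le_of_mul_le_mul_right (h1.trans (Nat.mul_le_mul_left _ ?_)) h2
          omega
        · simp [extendZero, not_lt.2 hi]
      intro i j hij
      simpa [extendZero] using hanti (Fin.le_def.1 hij)
    · rintro ⟨i, hi⟩ ⟨j, hj⟩ (rfl : j = i + 1)
      exact (hdiv i hj).2 (hstep i hj)
    · intro i hi
      refine div_nonneg (Nat.cast_nonneg _) (sub_nonneg.2 ?_)
      exact_mod_cast (by omega)
  · rintro ⟨-, h, -⟩
    refine ⟨fun i => ?_, fun i hi => dif_neg (not_lt.2 hi)⟩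
    rcases lt_or_ge (i + 1) k with hi | hi
    · have := (hdiv i hi).1 (h ⟨i, by omega⟩ ⟨i + 1, hi⟩ rfl)
      simpa [extendZero, hi, show i < k by omega] using this
    · simp [extendZero, not_lt.2 hi]

theorem encard_truncatedLectureHall {n k : ℕ} (hk : k ≤ n) (N : ℕ) :
    {l : Fin k → ℕ | l ∈ truncatedLectureHall n k ∧ ∑ i, l i = N}.encard =
      ({f | f ∈ lectureHallSeq n k ∧ ∑ i ∈ Finset.range n, f i = N}).encard := by
  rw [← (extendZero_injective k).encard_image]
  congr 1
  ext f
  constructor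
  · rintro ⟨l, ⟨hl, hN⟩, rfl⟩
    exact ⟨(extendZero_mem_lectureHallSeq hk l).2 hl, (sum_extendZero hk l).trans hN⟩
  · rintro ⟨hf, hN⟩
    have hfe : extendZero (fun i : Fin k => f i) = f := by
      funext i
      unfold extendZero
      split_ifs with h
      · rfl
      · exact (hf.2 i (not_lt.1 h)).symm
    refine ⟨fun i => f i, ⟨?_, ?_⟩, hfe⟩
    · rw [← extendZero_mem_lectureHallSeq hk, hfe]
      exact hf
    · rw [← sum_extendZero hk, hfe]
      exact hN

theorem encard_restrictedOddPartitions {n k : ℕ} (hk : k ≤ n) (N : ℕ) :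
    (restrictedOddPartitions n k N).encard =
      ({s | s ∈ boundedMultisets
        (oddNumbers (Finset.range ((k + 1) / 2) ∪ Finset.Ico (n - k / 2) n))
        (oddNumbers (Finset.Ico ((k + 1) / 2) (n - k / 2))) (k / 2 + 1) ∧ s.sum = N}).encard := by
  have hinj : Function.Injective (fun p : Nat.Partition N => p.parts) :=
    fun p p' h => Nat.Partition.ext h
  have hmem : ∀ x, (x ∈ oddNumbers (Finset.range ((k + 1) / 2) ∪ Finset.Ico (n - k / 2) n) ∨
      x ∈ oddNumbers (Finset.Ico ((k + 1) / 2) (n - k / 2))) ↔ Odd x ∧ x < 2 * n := by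
    intro x
    simp only [mem_oddNumbers, Finset.mem_union, Finset.mem_range, Finset.mem_Ico]
    constructor
    · rintro (⟨i, hi, rfl⟩ | ⟨i, hi, rfl⟩)
      · exact ⟨⟨i, rfl⟩, by omega⟩
      · exact ⟨⟨i, rfl⟩, by omega⟩
    · rintro ⟨⟨i, rfl⟩, hi⟩
      rw [← exists_or]
      exact ⟨i, by omega⟩
  have hcount : ∀ s : Multiset ℕ,
      s.countP (· ∈ oddNumbers (Finset.Ico ((k + 1) / 2) (n - k / 2))) =
        s.countP (fun a => IsRestrictedPart n k a) := by
    refine fun s => Multiset.countP_congr rfl fun x _ => ?_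
    simp only [mem_oddNumbers, Finset.mem_Ico, IsRestrictedPart, eq_iff_iff]
    constructor
    · rintro ⟨i, hi, rfl⟩
      exact ⟨⟨i, rfl⟩, by omega, by omega⟩
    · rintro ⟨⟨i, rfl⟩, h1, h2⟩
      exact ⟨i, by omega, rfl⟩
  rw [← hinj.encard_image]
  congr 1
  ext s
  constructor
  · rintro ⟨p, ⟨hp1, hp2⟩, rfl⟩
    exact ⟨⟨fun x hx => (hmem x).2 (hp1 x hx), (hcount _).symm ▸ Nat.lt_succ_of_le hp2⟩,
      p.parts_sum⟩
  · rintro ⟨⟨h1, h2⟩, h3⟩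
    refine ⟨⟨s, fun {x} hx => ((hmem x).1 (h1 x hx)).1.pos, h3⟩,
      ⟨fun x hx => (hmem x).1 (h1 x hx), ?_⟩, rfl⟩
    rw [← hcount]
    exact Nat.le_of_lt_succ h2

theorem mainTheorem5 (n k N : ℕ) (hkn : k ≤ n) :
    {l : Fin k → ℕ | l ∈ truncatedLectureHall n k ∧ ∑ i, l i = N}.encard =
      (restrictedOddPartitions n k N).encard := by
  have h := congrArg (PowerSeries.coeff N) (weightGenFun_lectureHallSeq_eq hkn)
  rw [restrictedOddGenFun, boundedGenFun, weightGenFun, weightGenFun, PowerSeries.coeff_mk,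
    PowerSeries.coeff_mk, Nat.cast_inj] at h
  rw [encard_truncatedLectureHall hkn, encard_restrictedOddPartitions hkn,
    ← Set.Finite.cast_ncard_eq, ← Set.Finite.cast_ncard_eq, h]
  · exact (finite_multiset_sum_eq N).subset fun s hs =>
      ⟨boundedMultisets_pos (zero_notMem_oddNumbers _) (zero_notMem_oddNumbers _) _ s hs.1, hs.2⟩
  · exact (finite_support_sum n N).subset
      fun f hf => ⟨fun i hi => hf.1.2 i (hkn.trans hi), hf.2⟩
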